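/- For real $a,\nu>0$ let $Q(a,\nu)=\frac{1}{\Gamma(a)}\int_\nu^\infty s^{a-1}e^{-s}\,ds$ be the regularised incomplete gamma function, and for integers $n\ge 1$ and $\nu>0$ let $$H_n(\nu)=\frac{\Gamma(n)\,Q(n,\nu)}{\nu^n e^{-\nu}}.$$ Let $\varphi(x)=e^{-x^2/2}/\sqrt{2\pi}$ and $\bar\Phi(x)=\int_x^\infty\varphi(t)\,dt$ be the standard normal density and tail distribution. Fix $\alpha\in\mathbb{R}$ and $\beta\ge 0$, and set $\lambda_n=1+\alpha n^{-\beta}$ (in each case below $\lambda_n>0$ for all large $n$). Then, as $n\to\infty$: 1. If $\beta=0$ and $\alpha\in(-1,0)$, then $$\frac{1}{H_n(n\lambda_n)}=\sqrt{\frac{n}{2\pi}}\,e^{-n[\alpha-\log(1+\alpha)]}\,[1+o(1)].$$ 2. If $\beta\in(0,1/2)$ and $\alpha<0$, then $$\frac{1}{H_n(n\lambda_n)}=\sqrt{\frac{n}{2\pi}}\,\exp\!\left(-\frac{\alpha^2}{2}n^{1-2\beta}[1+o(1)]\right)[1+o(1)].$$ 3. If $\beta=1/2$ and $\alpha\in\mathbb{R}$,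 then $$\frac{1}{H_n(n\lambda_n)}=\frac{\varphi(\alpha)}{\bar\Phi(\alpha)}\,\sqrt{n}\,[1+o(1)].$$ 4. If $\beta>1/2$ and $\alpha\in\mathbb{R}$, then $$\frac{1}{H_n(n\lambda_n)}=\sqrt{\frac{2}{\pi}}\,\sqrt{n}\,[1+o(1)].$$ 5. If $\beta\in(0,1/2)$ and $\alpha>0$, then $$\frac{1}{H_n(n\lambda_n)}=\alpha n^{1-\beta}\left[1+\frac{n^{2\beta-1}}{\alpha^2}+\frac{\mathbf{1}(\beta\le 1/3)\,n^{\beta-1}}{\alpha}-\frac{2n^{4\beta-2}}{\alpha^4}+o(n^{4\beta-2})\right],$$ where $\mathbf{1}(\beta\le 1/3)$ is $1$ if $\beta\le 1/3$ and $0$ otherwise. 6. If $\beta=0$ and $\alpha>0$, then $$\frac{1}{H_n(n\lambda_n)}=\alpha n\left[1+\frac{1+\alpha}{\alpha^2 n}-\frac{(1+\alpha)(2+\alpha)}{\alpha^4n^2}+O(n^{-3})\right].$$ -/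

import Mathlib

open Filter Asymptotics MeasureTheory

namespace SAWComplete

noncomputable section

/-- The regularised (upper) incomplete gamma function
`Q(a, ν) = (1 / Γ(a)) ∫_ν^∞ s^(a-1) e^(-s) ds`, meant for real `a, ν > 0`. -/
def Q (a ν : ℝ) : ℝ :=
  (1 / Real.Gamma a) * ∫ s in Set.Ioi ν, s ^ (a - 1) * Real.exp (-s)

/-- `H_n(ν) = Γ(n) Q(n, ν) / (ν^n e^(-ν))`, meant for `n ≥ 1` and `ν > 0`. -/
def H (n : ℕ) (ν : ℝ) : ℝ :=
  Real.Gamma (n : ℝ) * Q (n : ℝ) ν / (ν ^ n * Real.exp (-ν))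

/-- The sequence `λ_n = 1 + α n^(-β)`. -/
def lam (α β : ℝ) (n : ℕ) : ℝ := 1 + α * (n : ℝ) ^ (-β)

/-- The standard normal density. -/
def phi (x : ℝ) : ℝ := Real.exp (-x ^ 2 / 2) / Real.sqrt (2 * Real.pi)

/-- The standard normal tail distribution `∫_x^∞ φ(t) dt`. -/
def PhiBar (x : ℝ) : ℝ := ∫ t in Set.Ioi x, phi t

/-- `phi` is Mathlib's density of the Gaussian law with mean `0` and variance `1`. -/
theorem phi_eq_gaussianPDFReal (x : ℝ) : phi x = ProbabilityTheory.gaussianPDFReal 0 1 x := by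
  simp [phi, ProbabilityTheory.gaussianPDFReal, div_eq_inv_mul]

end

end SAWComplete

namespace SAWComplete

open Set Topology

/-! After cancelling `Γ(n)`, `H n ν` is the tail `∫_ν^∞ s^(n-1) e^(-s) ds` divided by `ν^n e^(-ν)`.
The integrand has its bulk near `n` with width `√n`, so the six cases reduce to three regimes,
according to the limit of `√n (λ_n - 1)`.

Limit `+∞`: the tail is governed by its endpoint. Repeated integration by parts gives a Mills-type
expansion in `1 / (ν - n)`; the residual of the truncation is positive and decreasing in `s`, which
turns it into a two-sided bound (`exists_H_mul_one_add_eq`) and then an explicit expansion of `1 /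
H` (`abs_one_div_H_mul_sub_le`).

Finite limit `c`: with `s = n λ_n (1 + t / √n)`, `√n H` becomes a Laplace integral whose integrand
tends to `exp(-t²/2 - c t)`. Dominated convergence gives `PhiBar c / phi c` (`tendsto_sqrt_mul_H`).
Here `c = α` for `β = 1/2` and `c = 0` for `β > 1/2`.

Limit `-∞`: by Chebyshev the tail carries almost all of the mass `(n-1)!`, and Stirling's formula
gives the rest (`tendsto_H_mul_of_lt`). -/

/-! ### The tail integral behind `H`. -/

theorem integrableOn_pow_mul_exp_neg (k : ℕ) {ν : ℝ} (hν : 0 ≤ ν) :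
    IntegrableOn (fun s : ℝ => s ^ k * Real.exp (-s)) (Ioi ν) := by
  have h := Real.GammaIntegral_convergent (s := (k : ℝ) + 1) (by positivity)
  refine (h.mono_set (Ioi_subset_Ioi hν)).congr_fun (fun s _ => ?_) measurableSet_Ioi
  simp [mul_comm]

theorem integral_pow_mul_exp_neg_pos (k : ℕ) {ν : ℝ} (hν : 0 ≤ ν) :
    0 < ∫ s in Ioi ν, s ^ k * Real.exp (-s) := by
  rw [setIntegral_pos_iff_support_of_nonneg_ae _ (integrableOn_pow_mul_exp_neg k hν)]
  · have : Function.support (fun s : ℝ => s ^ k * Real.exp (-s)) ∩ Ioi ν = Ioi ν := by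
      refine inter_eq_right.2 fun s hs => ?_
      have hs' : 0 < s := hν.trans_lt hs
      exact (by positivity : (s ^ k * Real.exp (-s)) ≠ 0)
    rw [this]
    simp
  · filter_upwards [ae_restrict_mem measurableSet_Ioi] with s hs
    have hs' : 0 < s := hν.trans_lt hs
    positivity

theorem H_eq_integral_div {n : ℕ} (hn : 1 ≤ n) (ν : ℝ) :
    H n ν = (∫ s in Ioi ν, s ^ (n - 1) * Real.exp (-s)) / (ν ^ n * Real.exp (-ν)) := by
  have hn0 : (0 : ℝ) < n := by exact_mod_cast hn
  have hG : Real.Gamma (n : ℝ) ≠ 0 := (Real.Gamma_pos_of_pos hn0).ne'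
  have hpow : ∀ s : ℝ, s ^ ((n : ℝ) - 1) = s ^ (n - 1) := fun s => by
    rw [← Real.rpow_natCast, Nat.cast_sub hn, Nat.cast_one]
  simp only [H, Q, hpow]
  rw [← mul_assoc, mul_one_div_cancel hG, one_mul]

/-! ### Above the transition: Mills-type expansion with explicit error. -/

/-- Three-term approximant to the Mills-type ratio `H n s`, in terms of `p = 1 / (s - n)`. -/
def millsApprox (n : ℕ) (p : ℝ) : ℝ :=
  p - p ^ 2 * (1 + n * p) + p ^ 3 * (1 + n * p) * (2 + 3 * (n * p))

/-- Relative residual left by `millsApprox`. -/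
def millsResidual (n : ℕ) (p : ℝ) : ℝ :=
  (1 + n * p) * (6 * (1 + n * p) ^ 2 + 8 * (n * p) * (1 + n * p) + (n * p) ^ 2) * p ^ 3

/-- `s^n e^(-s) F` is minus an exact antiderivative of `s^(n-1) e^(-s)` when `F = p + p s F'`.
Iterating from `F = p`, with `p s = 1 + n p` and `p' = -p²`, produces the three terms of
`millsApprox`; `millsResidual` is `-s` times the derivative of the last one. -/
theorem hasDerivAt_pow_mul_exp_neg_mul_millsApprox {n : ℕ} (hn : 1 ≤ n) {s : ℝ}
    (hs : (n : ℝ) < s) :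
    HasDerivAt (fun s : ℝ => s ^ n * Real.exp (-s) * millsApprox n (s - n)⁻¹)
      (-(s ^ (n - 1) * Real.exp (-s) * (1 + millsResidual n (s - n)⁻¹))) s := by
  have hD : s - n ≠ 0 := (sub_pos.2 hs).ne'
  have hp : HasDerivAt (fun s : ℝ => (s - n)⁻¹) (-1 / (s - n) ^ 2) s :=
    ((hasDerivAt_id s).sub_const (n : ℝ)).fun_inv hD
  have hF := (hp.sub ((hp.pow 2).mul ((hp.const_mul (n : ℝ)).const_add 1))).add
    (((hp.pow 3).mul ((hp.const_mul (n : ℝ)).const_add 1)).mul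
      (((hp.const_mul (n : ℝ)).const_mul 3).const_add 2))
  have hE := ((hasDerivAt_pow n s).mul ((hasDerivAt_neg s).exp)).mul hF
  refine hE.congr_deriv ?_
  obtain ⟨k, rfl⟩ : ∃ k, n = k + 1 := ⟨n - 1, by omega⟩
  simp only [millsResidual, Pi.mul_apply, Pi.sub_apply, Pi.add_apply, Pi.pow_apply,
    Nat.add_sub_cancel, pow_succ s k]
  generalize ((k + 1 : ℕ) : ℝ) = N at hD ⊢
  obtain ⟨t, rfl⟩ : ∃ t, s = N + t := ⟨s - N, by ring⟩
  simp only [add_sub_cancel_left, Nat.reduceSub, Nat.cast_ofNat] at hD ⊢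
  field_simp
  ring

theorem tendsto_pow_mul_exp_neg_mul_millsApprox (n : ℕ) :
    Tendsto (fun s : ℝ => s ^ n * Real.exp (-s) * millsApprox n (s - n)⁻¹) atTop (𝓝 0) := by
  have hp : Tendsto (fun s : ℝ => (s - n)⁻¹) atTop (𝓝 0) :=
    tendsto_inv_atTop_zero.comp (tendsto_atTop_add_const_right _ _ tendsto_id)
  have hc : Continuous (millsApprox n) := by unfold millsApprox; fun_prop
  have hF := (hc.tendsto 0).comp hp
  simpa using (Real.tendsto_pow_mul_exp_neg_atTop_nhds_zero n).mul hF

theorem millsResidual_nonneg (n : ℕ) {p : ℝ} (hp : 0 ≤ p) : 0 ≤ millsResidual n p := by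
  unfold millsResidual; positivity

theorem millsResidual_mono (n : ℕ) {p p' : ℝ} (hp : 0 ≤ p) (h : p ≤ p') :
    millsResidual n p ≤ millsResidual n p' := by
  have := hp.trans h
  unfold millsResidual
  gcongr

/-- Integrating the derivative identity over `(ν, ∞)` weights the tail by `1 + millsResidual`. This
factor is at least `1` and decreases in `s`, so its weighted average lies between `1` and its value
at `ν`. -/
theorem exists_H_mul_one_add_eq {n : ℕ} (hn : 1 ≤ n) {ν : ℝ} (hν : (n : ℝ) < ν) :
    ∃ e, 0 ≤ e ∧ e ≤ millsResidual n (ν - n)⁻¹ ∧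
      H n ν * (1 + e) = millsApprox n (ν - n)⁻¹ := by
  have hn0 : (0 : ℝ) ≤ n := n.cast_nonneg
  have hν0 : 0 < ν := hn0.trans_lt hν
  have hderiv : ∀ x ∈ Ici ν, HasDerivAt
      (fun s : ℝ => s ^ n * Real.exp (-s) * millsApprox n (s - n)⁻¹)
      (-(x ^ (n - 1) * Real.exp (-x) * (1 + millsResidual n (x - n)⁻¹))) x :=
    fun x hx => hasDerivAt_pow_mul_exp_neg_mul_millsApprox hn (hν.trans_le hx)
  have hres : ∀ x ∈ Ioi ν, 0 ≤ millsResidual n (x - n)⁻¹ := fun x hx =>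
    millsResidual_nonneg n (inv_nonneg.2 (sub_nonneg.2 (hν.trans hx).le))
  have hw : ∀ x ∈ Ioi ν, 0 ≤ x ^ (n - 1) * Real.exp (-x) := fun x hx => by
    have : 0 < x := hν0.trans hx
    positivity
  have hneg : ∀ x ∈ Ioi ν,
      -(x ^ (n - 1) * Real.exp (-x) * (1 + millsResidual n (x - n)⁻¹)) ≤ 0 := fun x hx => by
    have := hres x hx
    have := hw x hx
    rw [neg_nonpos]
    positivity
  have hlim := tendsto_pow_mul_exp_neg_mul_millsApprox n
  -- A derivative of constant sign whose primitive has a limit at infinity is integrable.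
  have hint := (integrableOn_Ioi_deriv_of_nonpos' hderiv hneg hlim).neg
  have hval := integral_Ioi_of_hasDerivAt_of_nonpos' hderiv hneg hlim
  rw [integral_neg, zero_sub, neg_inj] at hval
  simp only [Pi.neg_def, neg_neg] at hint
  have hT := integrableOn_pow_mul_exp_neg (n - 1) hν0.le
  have hTpos := integral_pow_mul_exp_neg_pos (n - 1) hν0.le
  set T := ∫ s in Ioi ν, s ^ (n - 1) * Real.exp (-s) with hTdef
  set g := ν ^ n * Real.exp (-ν) * millsApprox n (ν - n)⁻¹ with hg
  have hlow : T ≤ g := by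
    rw [← hval]
    refine setIntegral_mono_on hT hint measurableSet_Ioi fun x hx => ?_
    have := hres x hx
    exact le_mul_of_one_le_right (hw x hx) (by linarith)
  have hup : g ≤ T * (1 + millsResidual n (ν - n)⁻¹) := by
    rw [← hval, hTdef, ← integral_mul_const]
    refine setIntegral_mono_on hint (hT.mul_const _) measurableSet_Ioi fun x hx => ?_
    refine mul_le_mul_of_nonneg_left (add_le_add_right (millsResidual_mono n ?_ ?_) 1) (hw x hx)
    · exact inv_nonneg.2 (sub_nonneg.2 (hν.trans hx).le)
    · exact inv_anti₀ (sub_pos.2 hν) (sub_le_sub_right (le_of_lt hx) _)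
  refine ⟨g / T - 1, ?_, ?_, ?_⟩
  · rw [sub_nonneg, one_le_div hTpos]
    exact hlow
  · rw [sub_le_iff_le_add, div_le_iff₀ hTpos]
    linarith
  · rw [H_eq_integral_div hn, ← hTdef, hg]
    have := (Real.exp_pos (-ν)).ne'
    field_simp
    ring

/-- Two-term expansion of `1 / H n ν` above the transition point, with an explicit error. -/
theorem abs_one_div_H_mul_sub_le {n : ℕ} (hn : 1 ≤ n) {ν : ℝ} (hν : (n : ℝ) < ν)
    (ha : ν / (ν - n) ^ 2 ≤ 1 / 2) :
    |1 / (H n ν * (ν - n)) - (1 + ν / (ν - n) ^ 2 - ν * (ν + n) / (ν - n) ^ 4)| ≤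
      56 * (ν / (ν - n) ^ 2) ^ 3 := by
  obtain ⟨e, he0, he, hH⟩ := exists_H_mul_one_add_eq hn hν
  have hn0 : (0 : ℝ) ≤ n := n.cast_nonneg
  have hν0 : 0 < ν := hn0.trans_lt hν
  have hD : 0 < ν - n := sub_pos.2 hν
  -- `a` is the small parameter: `H n ν * (ν - n) * (1 + e) = 1 - a + b` with `b = O(a²)` and `e =
  -- O(a³)`, so the reciprocal is `1 + a + a² - b` up to `O(a³)`.
  obtain ⟨a, haν⟩ : ∃ a, a = ν / (ν - n) ^ 2 := ⟨_, rfl⟩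
  obtain ⟨b, hbν⟩ : ∃ b, b = ν * (2 * ν + n) / (ν - n) ^ 4 := ⟨_, rfl⟩
  have ha0 : 0 < a := by rw [haν]; positivity
  have hb0 : 0 ≤ b := by rw [hbν]; positivity
  have hb : b ≤ 3 * a ^ 2 := by
    rw [haν, hbν, div_pow, ← mul_div_assoc, ← pow_mul]
    refine div_le_div_of_nonneg_right ?_ (by positivity)
    nlinarith
  have he3 : e ≤ 15 * a ^ 3 := by
    refine he.trans ?_
    have : millsResidual n (ν - n)⁻¹ = ν * (6 * ν ^ 2 + 8 * n * ν + n ^ 2) / (ν - n) ^ 6 := by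
      unfold millsResidual
      field_simp
      ring
    rw [this, haν, div_pow, ← mul_div_assoc, ← pow_mul]
    refine div_le_div_of_nonneg_right ?_ (by positivity)
    have h1 : (n : ℝ) * ν ≤ ν ^ 2 := by nlinarith
    have h2 : (n : ℝ) ^ 2 ≤ ν ^ 2 := by gcongr
    nlinarith
  have hP : H n ν * (ν - n) * (1 + e) = 1 - a + b := by
    rw [mul_right_comm, hH, haν, hbν]
    unfold millsApprox
    field_simp
    ring
  have hT : 1 + ν / (ν - n) ^ 2 - ν * (ν + n) / (ν - n) ^ 4 = 1 + a + a ^ 2 - b := by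
    rw [haν, hbν]
    field_simp
    ring
  rw [hT, ← haν]
  rw [← haν] at ha
  have hPpos : 1 / 2 ≤ 1 - a + b := by linarith
  have hHD : 1 / (H n ν * (ν - n)) = (1 + e) / (1 - a + b) := by
    rw [← hP]
    have h1 : (1 : ℝ) + e ≠ 0 := by positivity
    have h2 : H n ν * (ν - n) ≠ 0 := fun h => by
      rw [h, zero_mul] at hP
      linarith
    field_simp
  have hkey : (1 + e) / (1 - a + b) - (1 + a + a ^ 2 - b) =
      (e + a ^ 3 - 2 * a * b - a ^ 2 * b + b ^ 2) / (1 - a + b) := by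
    have : 1 - a + b ≠ 0 := by linarith
    field_simp
    ring
  rw [hHD, hkey, abs_div, abs_of_pos (by linarith : 0 < 1 - a + b), div_le_iff₀ (by linarith)]
  have hab : a * b ≤ 3 * a ^ 3 := by nlinarith
  have haab : a ^ 2 * b ≤ 3 / 2 * a ^ 3 := by nlinarith [pow_pos ha0 3]
  have hbb : b ^ 2 ≤ 9 / 2 * a ^ 3 := by nlinarith [pow_pos ha0 3]
  have h0 : 0 ≤ a * b := by positivity
  have h1 : 0 ≤ a ^ 2 * b := by positivity
  have h2 : 0 ≤ b ^ 2 := by positivity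
  have h3 := pow_pos ha0 3
  -- The numerator is at most `28 a³` in absolute value; the denominator is at least `1/2`, which
  -- doubles this to 56.
  have h4 : 28 * a ^ 3 ≤ 56 * a ^ 3 * (1 - a + b) := by nlinarith
  refine le_trans ?_ h4
  rw [abs_le]
  constructor <;> nlinarith

/-! ### Transition window: Laplace integral and Gaussian limit. -/

theorem integral_Ioi_zero_comp_add (f : ℝ → ℝ) (c : ℝ) :
    ∫ t in Ioi 0, f (t + c) = ∫ s in Ioi c, f s := by
  have h := (measurePreserving_add_right (volume : Measure ℝ) c).setIntegral_preimage_emb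
    (measurableEmbedding_addRight c) f (Ioi c)
  simpa using h

theorem integrable_phi : Integrable phi := by
  have := ProbabilityTheory.integrable_gaussianPDFReal 0 1
  exact this.congr (ae_of_all _ fun x => (phi_eq_gaussianPDFReal x).symm)

theorem phi_pos (x : ℝ) : 0 < phi x := by unfold phi; positivity

theorem PhiBar_pos (x : ℝ) : 0 < PhiBar x := by
  unfold PhiBar
  rw [setIntegral_pos_iff_support_of_nonneg_ae (ae_of_all _ fun t => (phi_pos t).le)
    integrable_phi.integrableOn]
  have : Function.support phi = univ := Set.eq_univ_of_forall fun t => (phi_pos t).ne'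
  simp [this]

theorem integral_exp_neg_sq_div_two_sub (c : ℝ) :
    ∫ t in Ioi (0 : ℝ), Real.exp (-t ^ 2 / 2 - c * t) = PhiBar c / phi c := by
  rw [eq_div_iff (phi_pos c).ne', ← integral_mul_const, PhiBar,
    ← integral_Ioi_zero_comp_add phi]
  refine setIntegral_congr_fun measurableSet_Ioi fun t _ => ?_
  simp only [phi]
  rw [← mul_div_assoc, ← Real.exp_add]
  ring_nf

theorem phi_zero_div_PhiBar_zero : phi 0 / PhiBar 0 = Real.sqrt (2 / Real.pi) := by
  have h := integral_exp_neg_sq_div_two_sub 0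
  have h2 := integral_gaussian_Ioi (1 / 2)
  have : ∀ t : ℝ, Real.exp (-t ^ 2 / 2 - 0 * t) = Real.exp (-(1 / 2) * t ^ 2) := fun t => by
    ring_nf
  simp only [this, h2] at h
  rw [← inv_div, ← h, inv_div]
  have hπ := Real.pi_pos
  rw [div_eq_iff (by positivity), ← Real.sqrt_mul (by positivity)]
  have : 2 / Real.pi * (Real.pi / (1 / 2)) = 2 ^ 2 := by field_simp
  rw [this, Real.sqrt_sq (by norm_num)]

/-- Second-order expansion of `log (1 + x)` at `0`. -/
theorem abs_log_one_add_sub_le {x : ℝ} (h : |x| ≤ 1 / 2) :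
    |Real.log (1 + x) - x + x ^ 2 / 2| ≤ 2 * |x| ^ 3 := by
  have h1 : |-x| < 1 := by rw [abs_neg]; linarith
  have := Real.abs_log_sub_add_sum_range_le h1 2
  simp only [Finset.sum_range_succ, Finset.sum_range_zero, abs_neg] at this
  refine le_trans (le_of_eq ?_) (this.trans ?_)
  · congr 1
    norm_num
    ring
  · rw [div_le_iff₀ (by linarith)]
    have := pow_nonneg (abs_nonneg x) 3
    norm_num only
    nlinarith

/-- The quadratic Taylor term gives the limit; the cubic error is of order `n |x|³ = (√n x)² |x|`,
which vanishes since `x → 0`. -/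
theorem tendsto_nat_mul_log_one_add_sub {x : ℕ → ℝ} {c : ℝ}
    (hx : Tendsto (fun n : ℕ => Real.sqrt n * x n) atTop (𝓝 c)) :
    Tendsto (fun n : ℕ => n * (Real.log (1 + x n) - x n)) atTop (𝓝 (-c ^ 2 / 2)) := by
  have hs : Tendsto (fun n : ℕ => Real.sqrt n) atTop atTop :=
    Real.tendsto_sqrt_atTop.comp tendsto_natCast_atTop_atTop
  have hx0 : Tendsto x atTop (𝓝 0) := by
    have := hx.mul (tendsto_inv_atTop_zero.comp hs)
    rw [mul_zero] at this
    refine this.congr' ?_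
    filter_upwards [hs.eventually_gt_atTop 0] with n hn
    simp only [Function.comp]
    field_simp
  have hmain : Tendsto (fun n : ℕ => -(Real.sqrt n * x n) ^ 2 / 2) atTop (𝓝 (-c ^ 2 / 2)) :=
    ((hx.pow 2).neg).div_const 2
  have herr : Tendsto (fun n : ℕ => 2 * (Real.sqrt n * x n) ^ 2 * |x n|) atTop (𝓝 0) := by
    simpa using ((hx.pow 2).const_mul 2).mul hx0.abs
  have hdiff : Tendsto (fun n : ℕ => n * (Real.log (1 + x n) - x n) -
      -(Real.sqrt n * x n) ^ 2 / 2) atTop (𝓝 0) := by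
    refine squeeze_zero_norm' ?_ herr
    have := hx0.abs
    rw [abs_zero] at this
    filter_upwards [this.eventually_le_const (by norm_num : (0 : ℝ) < 1 / 2)] with n hn
    have h := abs_log_one_add_sub_le hn
    have hsq : Real.sqrt n ^ 2 = n := Real.sq_sqrt n.cast_nonneg
    rw [Real.norm_eq_abs, mul_pow, hsq]
    have e1 : (n : ℝ) * (Real.log (1 + x n) - x n) - -(n * x n ^ 2) / 2 =
      n * (Real.log (1 + x n) - x n + x n ^ 2 / 2) := by ring
    have e2 : 2 * ((n : ℝ) * x n ^ 2) * |x n| = n * (2 * |x n| ^ 3) := by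
      rw [pow_succ |x n| 2, sq_abs]; ring
    rw [e1, e2, abs_mul, Nat.abs_cast]
    gcongr
  simpa using hdiff.add hmain

/-- Laplace-integral form of `H n` on the scale `n ^ (-1/2)`. -/
theorem sqrt_mul_H_eq {n : ℕ} (hn : 1 ≤ n) {l : ℝ} (hl : 0 < l) :
    Real.sqrt n * H n (n * l) = ∫ t in Ioi (0 : ℝ),
      Real.exp (n * (Real.log (1 + t / Real.sqrt n) - t / Real.sqrt n) -
        Real.sqrt n * (l - 1) * t) / (1 + t / Real.sqrt n) := by
  have hn0 : (0 : ℝ) < n := by exact_mod_cast hn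
  obtain ⟨r, hr⟩ : ∃ r, r = Real.sqrt n := ⟨_, rfl⟩
  have hr0 : 0 < r := by rw [hr]; positivity
  have hrn : (n : ℝ) = r ^ 2 := by rw [hr, Real.sq_sqrt n.cast_nonneg]
  have hb : 0 < r * l := by positivity
  rw [H_eq_integral_div hn, ← integral_Ioi_zero_comp_add, ← hr]
  -- The substitution is `s = n l + √n l t = n l (1 + t / √n)`.
  have hsc := integral_comp_mul_left_Ioi'
    (fun s : ℝ => (s + n * l) ^ (n - 1) * Real.exp (-(s + n * l))) 0 hb
  simp only [smul_eq_mul, mul_zero] at hsc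
  rw [← hsc, mul_div_assoc', div_eq_iff (by positivity), ← integral_const_mul,
    ← integral_const_mul, ← integral_mul_const]
  refine setIntegral_congr_fun measurableSet_Ioi fun t ht => ?_
  have ht0 : (0 : ℝ) < t := ht
  have h1 : 0 < 1 + t / r := by positivity
  have hpow : (n : ℝ) * Real.log (1 + t / r) = Real.log ((1 + t / r) ^ n) := by
    rw [Real.log_pow]
  have hexp : Real.exp (n * (Real.log (1 + t / r) - t / r) - r * (l - 1) * t) =
      (1 + t / r) ^ n * Real.exp (-(r * l * t)) := by
    have : (n : ℝ) * (Real.log (1 + t / r) - t / r) - r * (l - 1) * t =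
        n * Real.log (1 + t / r) + -(r * l * t) := by
      have : (n : ℝ) * (t / r) = r * t := by rw [hrn]; field_simp
      rw [mul_sub, this]
      ring
    rw [this, Real.exp_add, hpow, Real.exp_log (by positivity)]
  have hsum : r * l * t + n * l = n * l * (1 + t / r) := by
    rw [hrn]; field_simp; ring
  rw [hexp, neg_add, Real.exp_add, hsum, mul_pow]
  obtain ⟨k, rfl⟩ : ∃ k, n = k + 1 := ⟨n - 1, by omega⟩
  rw [Nat.add_sub_cancel, pow_succ (1 + t / r) k, pow_succ (((k + 1 : ℕ) : ℝ) * l) k]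
  have : r * (r * l) = ((k + 1 : ℕ) : ℝ) * l := by rw [hrn]; ring
  field_simp
  rw [hrn]

/-- Tangent-line bound used to dominate the rescaled integrand. -/
theorem nat_mul_log_one_add_sub_le {n : ℕ} {M t : ℝ} (hM : 0 ≤ M) (hMn : M ≤ Real.sqrt n)
    (hn : 1 ≤ n) (ht : 0 ≤ t) :
    n * (Real.log (1 + t / Real.sqrt n) - t / Real.sqrt n) ≤ M ^ 2 - M / 2 * t := by
  obtain ⟨r, hr⟩ : ∃ r, r = Real.sqrt n := ⟨_, rfl⟩
  have hn0 : (0 : ℝ) < n := by exact_mod_cast hn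
  have hr0 : 0 < r := by rw [hr]; positivity
  have hrn : (n : ℝ) = r ^ 2 := by rw [hr, Real.sq_sqrt n.cast_nonneg]
  rw [← hr] at hMn ⊢
  have h1 : 0 < 1 + M / r := by positivity
  have h2 : 0 < 1 + t / r := by positivity
  have hlog : Real.log (1 + t / r) ≤ M / r + (t - M) / (r + M) := by
    have e : Real.log (1 + t / r) = Real.log (1 + M / r) + Real.log ((1 + t / r) / (1 + M / r)) := by
      rw [Real.log_div h2.ne' h1.ne']; ring
    have l1 := Real.log_le_sub_one_of_pos h1
    have l2 := Real.log_le_sub_one_of_pos (div_pos h2 h1)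
    have e2 : (1 + t / r) / (1 + M / r) - 1 = (t - M) / (r + M) := by field_simp; ring
    linarith
  have hrM : 0 < r + M := by linarith
  calc n * (Real.log (1 + t / r) - t / r)
      ≤ r ^ 2 * (M / r + (t - M) / (r + M) - t / r) := by rw [hrn]; gcongr
    _ = r * M * (M - t) / (r + M) := by field_simp; ring
    -- `M ≤ r` puts `r / (r + M)` between `1/2` and `1`, whence the slope `M / 2`.
    _ ≤ M ^ 2 - M / 2 * t := by
      rw [div_le_iff₀ hrM]
      nlinarith [mul_nonneg (mul_nonneg hM ht) (sub_nonneg.2 hMn), pow_nonneg hM 3]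

theorem tendsto_sqrt_mul_H {l : ℕ → ℝ} {c : ℝ}
    (hl : Tendsto (fun n : ℕ => Real.sqrt n * (l n - 1)) atTop (𝓝 c)) (hpos : ∀ᶠ n in atTop, 0 < l n) :
    Tendsto (fun n : ℕ => Real.sqrt n * H n (n * l n)) atTop (𝓝 (PhiBar c / phi c)) := by
  have hs : Tendsto (fun n : ℕ => Real.sqrt n) atTop atTop :=
    Real.tendsto_sqrt_atTop.comp tendsto_natCast_atTop_atTop
  -- The decay rate `M / 2 = |c| + 2` beats the drift, eventually at most `|c| + 1`, and leaves
  -- `e^(-t)` as dominating function.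
  obtain ⟨M, hM⟩ : ∃ M, M = 2 * (|c| + 2) := ⟨_, rfl⟩
  have hM0 : 0 ≤ M := by rw [hM]; positivity
  rw [← integral_exp_neg_sq_div_two_sub]
  have hdom : Tendsto (fun n : ℕ => ∫ t in Ioi (0 : ℝ),
      Real.exp (n * (Real.log (1 + t / Real.sqrt n) - t / Real.sqrt n) -
        Real.sqrt n * (l n - 1) * t) / (1 + t / Real.sqrt n)) atTop
      (𝓝 (∫ t in Ioi (0 : ℝ), Real.exp (-t ^ 2 / 2 - c * t))) := by
    refine tendsto_integral_filter_of_dominated_convergence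
      (fun t => Real.exp (M ^ 2) * Real.exp (-1 * t)) ?_ ?_ ?_ ?_
    · exact Eventually.of_forall fun n => (by fun_prop : Measurable _).aestronglyMeasurable
    · filter_upwards [hs.eventually_ge_atTop M, eventually_ge_atTop 1,
        hl.eventually_const_le (by linarith [neg_abs_le c] : -(|c| + 1) < c)] with n hn hn1 hc
      filter_upwards [ae_restrict_mem measurableSet_Ioi] with t ht
      have ht0 : (0 : ℝ) < t := ht
      have hd : 1 ≤ 1 + t / Real.sqrt n := by
        have : 0 ≤ t / Real.sqrt n := by positivity
        linarith
      rw [Real.norm_eq_abs, abs_of_nonneg (by positivity), ← Real.exp_add]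
      refine (div_le_self (Real.exp_pos _).le hd).trans (Real.exp_le_exp.2 ?_)
      have := nat_mul_log_one_add_sub_le hM0 hn hn1 ht0.le
      have h2 := mul_le_mul_of_nonneg_right hc ht0.le
      have h3 : M / 2 * t = (|c| + 2) * t := by rw [hM]; ring
      linarith
    · exact (integrableOn_exp_mul_Ioi (by norm_num) 0).const_mul _
    · refine ae_of_all _ fun t => ?_
      have hx : Tendsto (fun n : ℕ => Real.sqrt n * (t / Real.sqrt n)) atTop (𝓝 t) := by
        refine tendsto_const_nhds.congr' ?_
        filter_upwards [hs.eventually_gt_atTop 0] with n hn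
        field_simp
      have h1 := tendsto_nat_mul_log_one_add_sub hx
      have h2 := (Real.continuous_exp.tendsto _).comp (h1.sub (hl.mul_const t))
      have h3 : Tendsto (fun n : ℕ => 1 + t / Real.sqrt n) atTop (𝓝 (1 + 0)) :=
        (hs.const_div_atTop t).const_add 1
      have h4 := h2.div h3 (by norm_num)
      rw [add_zero, div_one] at h4
      exact h4
  refine hdom.congr' ?_
  filter_upwards [hpos, eventually_ge_atTop 1] with n hn hn1
  exact (sqrt_mul_H_eq hn1 hn).symm

/-! ### Below the transition: Chebyshev and Stirling. -/

theorem integral_Ioi_zero_pow_mul_exp_neg (k : ℕ) :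
    ∫ s in Ioi (0 : ℝ), s ^ k * Real.exp (-s) = k.factorial := by
  rw [← Real.Gamma_nat_eq_factorial, Real.Gamma_eq_integral (by positivity)]
  refine setIntegral_congr_fun measurableSet_Ioi fun s _ => ?_
  simp [mul_comm]

theorem integral_pow_mul_exp_neg_le (k : ℕ) {ν : ℝ} (hν : 0 ≤ ν) :
    ∫ s in Ioi ν, s ^ k * Real.exp (-s) ≤ k.factorial := by
  rw [← integral_Ioi_zero_pow_mul_exp_neg]
  refine setIntegral_mono_set (integrableOn_pow_mul_exp_neg k le_rfl) ?_
    (Ioi_subset_Ioi hν).eventuallyLE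
  filter_upwards [ae_restrict_mem measurableSet_Ioi] with s hs
  have hs' : (0 : ℝ) < s := hs
  positivity

/-- Chebyshev's inequality for the Gamma law with shape `k + 1`, below its mean. -/
theorem factorial_mul_le_integral_pow_mul_exp_neg (k : ℕ) {ν : ℝ} (hν : 0 ≤ ν)
    (hνk : ν < k + 1) :
    k.factorial * (1 - (k + 1) / (k + 1 - ν) ^ 2) ≤ ∫ s in Ioi ν, s ^ k * Real.exp (-s) := by
  have hd : 0 < (k : ℝ) + 1 - ν := by linarith
  have i0 := integrableOn_pow_mul_exp_neg k le_rfl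
  have i1 := (integrableOn_pow_mul_exp_neg (k + 1) le_rfl).const_mul (2 * ((k : ℝ) + 1))
  have i2 := integrableOn_pow_mul_exp_neg (k + 2) le_rfl
  have i0' := i0.const_mul (((k : ℝ) + 1) ^ 2)
  have heq : ∀ s : ℝ, s ^ k * Real.exp (-s) * (s - (k + 1)) ^ 2 =
      s ^ (k + 2) * Real.exp (-s) - 2 * ((k : ℝ) + 1) * (s ^ (k + 1) * Real.exp (-s)) +
        ((k : ℝ) + 1) ^ 2 * (s ^ k * Real.exp (-s)) := fun s => by ring
  have ivar : IntegrableOn (fun s : ℝ => s ^ k * Real.exp (-s) * (s - (k + 1)) ^ 2) (Ioi 0) := by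
    simp only [heq]
    exact (i2.sub i1).add i0'
  have hvar : ∫ s in Ioi (0 : ℝ), s ^ k * Real.exp (-s) * (s - (k + 1)) ^ 2 =
      ((k : ℝ) + 1) * k.factorial := by
    simp only [heq]
    have i21 : IntegrableOn (fun s : ℝ => s ^ (k + 2) * Real.exp (-s) -
        2 * ((k : ℝ) + 1) * (s ^ (k + 1) * Real.exp (-s))) (Ioi 0) := i2.sub i1
    rw [integral_add i21 i0', integral_sub i2 i1, integral_const_mul, integral_const_mul]
    simp only [integral_Ioi_zero_pow_mul_exp_neg, Nat.factorial_succ]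
    push_cast
    ring
  have hsplit : (∫ s in Ioc 0 ν, s ^ k * Real.exp (-s)) + ∫ s in Ioi ν, s ^ k * Real.exp (-s) =
      k.factorial := by
    rw [← integral_Ioi_zero_pow_mul_exp_neg, ← setIntegral_union (Ioc_disjoint_Ioi le_rfl)
      measurableSet_Ioi (i0.mono_set Ioc_subset_Ioi_self) (i0.mono_set (Ioi_subset_Ioi hν)),
      Ioc_union_Ioi_eq_Ioi hν]
  have hcheb : ∫ s in Ioc 0 ν, s ^ k * Real.exp (-s) ≤
      ((k : ℝ) + 1) * k.factorial / (k + 1 - ν) ^ 2 := by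
    have ivar' : IntegrableOn (fun s : ℝ => s ^ k * Real.exp (-s) * (s - (k + 1)) ^ 2 /
        (k + 1 - ν) ^ 2) (Ioi 0) := ivar.div_const _
    rw [← hvar, ← integral_div]
    refine (setIntegral_mono_on (i0.mono_set Ioc_subset_Ioi_self)
      (ivar'.mono_set Ioc_subset_Ioi_self) measurableSet_Ioc fun s hs => ?_).trans
      (setIntegral_mono_set ivar' ?_ Ioc_subset_Ioi_self.eventuallyLE)
    · have hs0 : 0 < s := hs.1
      rw [mul_div_assoc]
      refine le_mul_of_one_le_right (by positivity) ((one_le_div (by positivity)).2 ?_)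
      have := hs.2
      nlinarith
    · filter_upwards [ae_restrict_mem measurableSet_Ioi] with s hs
      have hs' : (0 : ℝ) < s := hs
      positivity
  have : (k.factorial : ℝ) * (1 - (k + 1) / (k + 1 - ν) ^ 2) =
      k.factorial - (k + 1) * k.factorial / (k + 1 - ν) ^ 2 := by ring
  linarith

/-- Below the transition point, `H n` is asymptotic to the full Gamma integral. -/
theorem tendsto_H_mul_of_lt {l : ℕ → ℝ} (hl0 : ∀ᶠ n in atTop, 0 < l n)
    (hl1 : ∀ᶠ n in atTop, l n < 1)
    (hl : Tendsto (fun n : ℕ => (n : ℝ) * (1 - l n) ^ 2) atTop atTop) :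
    Tendsto (fun n : ℕ => H n (n * l n) * (Real.sqrt (n / (2 * Real.pi)) *
      Real.exp (-(n * (l n - 1 - Real.log (l n)))))) atTop (𝓝 1) := by
  have hratio : Tendsto (fun n : ℕ => (∫ s in Ioi (n * l n), s ^ (n - 1) * Real.exp (-s)) /
      (n - 1).factorial) atTop (𝓝 1) := by
    -- This is the Chebyshev lower bound at `ν = n * l n`, where variance over squared distance is
    -- `n / (n (1 - l n))²`.
    have hinv : Tendsto (fun n : ℕ => 1 - ((n : ℝ) * (1 - l n) ^ 2)⁻¹) atTop (𝓝 1) := by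
      simpa using (tendsto_inv_atTop_zero.comp hl).const_sub 1
    refine tendsto_of_tendsto_of_tendsto_of_le_of_le' hinv tendsto_const_nhds ?_ ?_
    · filter_upwards [hl0, hl1, eventually_ge_atTop 1] with n h0 h1 hn
      obtain ⟨k, rfl⟩ : ∃ k, n = k + 1 := ⟨n - 1, by omega⟩
      have hk : (0 : ℝ) < (k : ℝ) + 1 := by positivity
      rw [le_div_iff₀ (by positivity), mul_comm]
      rw [Nat.add_sub_cancel]
      push_cast
      refine le_trans (le_of_eq ?_) (factorial_mul_le_integral_pow_mul_exp_neg k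
        (mul_pos hk h0).le (mul_lt_of_lt_one_right hk h1))
      have h2 : 1 - l (k + 1) ≠ 0 := (sub_pos.2 h1).ne'
      have h3 : (k : ℝ) + 1 - (k + 1) * l (k + 1) = (k + 1) * (1 - l (k + 1)) := by ring
      rw [h3]
      field_simp
    · filter_upwards [hl0] with n h0
      rw [div_le_one (by positivity)]
      exact integral_pow_mul_exp_neg_le _ (by positivity)
  have hstirling : Tendsto (fun n : ℕ => (n.factorial : ℝ) /
      (Real.sqrt (2 * n * Real.pi) * (n / Real.exp 1) ^ n)) atTop (𝓝 1) := by
    refine (isEquivalent_iff_tendsto_one ?_).1 Stirling.factorial_isEquivalent_stirling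
    filter_upwards [eventually_ge_atTop 1] with n hn
    have : (0 : ℝ) < n := by exact_mod_cast hn
    have := Real.pi_pos
    positivity
  have hprod := hratio.mul hstirling
  rw [one_mul] at hprod
  refine hprod.congr' ?_
  filter_upwards [hl0, eventually_ge_atTop 1] with n h0 hn
  have hn0 : (0 : ℝ) < n := by exact_mod_cast hn
  have hπ := Real.pi_pos
  have hexp : Real.exp (-(n * (l n - 1 - Real.log (l n)))) =
      Real.exp (-(n * l n)) * Real.exp 1 ^ n * l n ^ n := by
    have : -(n * (l n - 1 - Real.log (l n))) = -(n * l n) + n * 1 + n * Real.log (l n) := by ring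
    rw [this, Real.exp_add, Real.exp_add, Real.exp_nat_mul, Real.exp_nat_mul, Real.exp_log h0]
  have hsqrt : Real.sqrt (n / (2 * Real.pi)) = n / Real.sqrt (2 * n * Real.pi) := by
    rw [eq_div_iff (by positivity), ← Real.sqrt_mul (by positivity)]
    have : n / (2 * Real.pi) * (2 * n * Real.pi) = (n : ℝ) ^ 2 := by field_simp
    rw [this, Real.sqrt_sq hn0.le]
  have hfact : (n.factorial : ℝ) = n * (n - 1).factorial := by
    exact_mod_cast (Nat.mul_factorial_pred (by omega)).symm
  rw [H_eq_integral_div hn, hexp, hsqrt, hfact, div_pow, mul_pow]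
  field_simp

/-! ### Specialisation to `λ_n = 1 + α n^(-β)`. -/

theorem exists_isLittleO_one_div_eq {f g : ℕ → ℝ}
    (h : Tendsto (fun n => f n * g n) atTop (𝓝 1)) :
    ∃ ε : ℕ → ℝ, ε =o[atTop] (fun _ => (1 : ℝ)) ∧ ∀ᶠ n in atTop, 1 / f n = g n * (1 + ε n) := by
  refine ⟨fun n => 1 / (f n * g n) - 1, ?_, ?_⟩
  · rw [isLittleO_one_iff]
    simpa using (h.inv₀ one_ne_zero).sub_const 1
  · filter_upwards [h.eventually_ne one_ne_zero] with n hn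
    have h1 := left_ne_zero_of_mul hn
    have h2 := right_ne_zero_of_mul hn
    field_simp
    ring

theorem tendsto_natCast_rpow_neg {b : ℝ} (hb : b < 0) :
    Tendsto (fun n : ℕ => (n : ℝ) ^ b) atTop (𝓝 0) := by
  have := (tendsto_rpow_neg_atTop (neg_pos.2 hb)).comp (tendsto_natCast_atTop_atTop (R := ℝ))
  simpa [Function.comp_def] using this

theorem isLittleO_natCast_rpow_rpow {p q : ℝ} (h : p < q) :
    (fun n : ℕ => (n : ℝ) ^ p) =o[atTop] (fun n : ℕ => (n : ℝ) ^ q) := by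
  have hmul : (fun n : ℕ => (n : ℝ) ^ (p - q) * (n : ℝ) ^ q) =o[atTop]
      (fun n : ℕ => 1 * (n : ℝ) ^ q) :=
    ((isLittleO_one_iff ℝ).2 (tendsto_natCast_rpow_neg (sub_neg.2 h))).mul_isBigO
      (isBigO_refl _ _)
  refine hmul.congr' ?_ ?_
  · filter_upwards [eventually_ge_atTop 1] with n hn
    rw [← Real.rpow_add (by exact_mod_cast hn), sub_add_cancel]
  · simp

theorem tendsto_lam (α : ℝ) {β : ℝ} (hβ : 0 < β) : Tendsto (lam α β) atTop (𝓝 1) := by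
  have := ((tendsto_natCast_rpow_neg (neg_neg_iff_pos.2 hβ)).const_mul α).const_add 1
  rwa [mul_zero, add_zero] at this

theorem exists_one_div_H_eq_central {α β c : ℝ}
    (hc : Tendsto (fun n : ℕ => Real.sqrt n * (lam α β n - 1)) atTop (𝓝 c))
    (hpos : ∀ᶠ n in atTop, 0 < lam α β n) :
    ∃ ε : ℕ → ℝ, ε =o[atTop] (fun _ => (1 : ℝ)) ∧ ∀ᶠ n : ℕ in atTop,
      1 / H n (n * lam α β n) = phi c / PhiBar c * Real.sqrt n * (1 + ε n) := by
  have h := (tendsto_sqrt_mul_H hc hpos).mul_const (phi c / PhiBar c)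
  rw [div_mul_div_cancel₀ (phi_pos c).ne', div_self (PhiBar_pos c).ne'] at h
  exact exists_isLittleO_one_div_eq (h.congr fun n => by ring)

theorem sqrt_mul_lam_sub_one {n : ℕ} (hn : 1 ≤ n) (α β : ℝ) :
    Real.sqrt n * (lam α β n - 1) = α * (n : ℝ) ^ (1 / 2 - β) := by
  have hn0 : (0 : ℝ) < n := by exact_mod_cast hn
  rw [lam, Real.sqrt_eq_rpow, sub_eq_add_neg (1 / 2) β, Real.rpow_add hn0]
  ring

theorem nat_mul_lam_sub_one_sq {n : ℕ} (hn : 1 ≤ n) (α β : ℝ) :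
    (n : ℝ) * (lam α β n - 1) ^ 2 = α ^ 2 * (n : ℝ) ^ (1 - 2 * β) := by
  have hn0 : (0 : ℝ) < n := by exact_mod_cast hn
  have h1 : (1 : ℝ) - 2 * β = 1 + (-β + -β) := by ring
  rw [lam, h1, Real.rpow_add hn0, Real.rpow_add hn0, Real.rpow_one]
  ring

theorem exists_one_div_H_eq_lower {α β : ℝ} (hβ : β < 1 / 2) (hα : α < 0)
    (hpos : ∀ᶠ n in atTop, 0 < lam α β n) :
    ∃ ε : ℕ → ℝ, ε =o[atTop] (fun _ => (1 : ℝ)) ∧ ∀ᶠ n : ℕ in atTop,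
      1 / H n (n * lam α β n) = Real.sqrt (n / (2 * Real.pi)) *
        Real.exp (-(n * (lam α β n - 1 - Real.log (lam α β n)))) * (1 + ε n) := by
  refine exists_isLittleO_one_div_eq (tendsto_H_mul_of_lt hpos ?_ ?_)
  · filter_upwards [eventually_ge_atTop 1] with n hn
    have hn0 : (0 : ℝ) < n := by exact_mod_cast hn
    have := mul_neg_of_neg_of_pos hα (Real.rpow_pos_of_pos hn0 (-β))
    rw [lam]
    linarith
  · have h := ((tendsto_rpow_atTop (by linarith : 0 < 1 - 2 * β)).comp
      (tendsto_natCast_atTop_atTop (R := ℝ))).const_mul_atTop (sq_pos_of_neg hα)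
    refine h.congr' ?_
    filter_upwards [eventually_ge_atTop 1] with n hn
    rw [Function.comp, ← nat_mul_lam_sub_one_sq hn]
    ring

theorem tendsto_log_one_add_ratio {x : ℕ → ℝ} (hx : Tendsto x atTop (𝓝 0))
    (hx0 : ∀ᶠ n in atTop, x n ≠ 0) :
    Tendsto (fun n => 2 * (x n - Real.log (1 + x n)) / x n ^ 2 - 1) atTop (𝓝 0) := by
  have habs := hx.abs
  rw [abs_zero] at habs
  refine squeeze_zero_norm' ?_ (by simpa using habs.const_mul 4)
  filter_upwards [hx0, habs.eventually_le_const (by norm_num : (0 : ℝ) < 1 / 2)] with n h0 hn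
  have h := abs_log_one_add_sub_le hn
  have e : 2 * (x n - Real.log (1 + x n)) / x n ^ 2 - 1 =
      -(2 * (Real.log (1 + x n) - x n + x n ^ 2 / 2)) / x n ^ 2 := by
    field_simp
    ring
  rw [e, Real.norm_eq_abs, abs_div, abs_neg, abs_mul, abs_two, abs_of_nonneg (sq_nonneg (x n)),
    div_le_iff₀ (by positivity), ← sq_abs (x n)]
  rw [← sq_abs (x n)] at h
  linarith [pow_succ |x n| 2]

theorem exists_one_div_H_eq_moderate_lower {α β : ℝ} (hβ0 : 0 < β) (hβ : β < 1 / 2)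
    (hα : α < 0) :
    ∃ δ ε : ℕ → ℝ, δ =o[atTop] (fun _ => (1 : ℝ)) ∧ ε =o[atTop] (fun _ => (1 : ℝ)) ∧
      ∀ᶠ n : ℕ in atTop, 1 / H n (n * lam α β n) = Real.sqrt (n / (2 * Real.pi)) *
        Real.exp (-(α ^ 2 / 2) * (n : ℝ) ^ (1 - 2 * β) * (1 + δ n)) * (1 + ε n) := by
  have hlam := tendsto_lam α hβ0
  obtain ⟨ε, hε, h⟩ := exists_one_div_H_eq_lower hβ hα (hlam.eventually_const_lt one_pos)
  have hx0 : ∀ n : ℕ, 1 ≤ n → lam α β n - 1 ≠ 0 := fun n hn => by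
    have hn0 : (0 : ℝ) < n := by exact_mod_cast hn
    rw [lam, add_sub_cancel_left]
    exact mul_ne_zero hα.ne (Real.rpow_pos_of_pos hn0 _).ne'
  have hx : Tendsto (fun n => lam α β n - 1) atTop (𝓝 0) := by simpa using hlam.sub_const 1
  -- With `x = λ_n - 1`, the witness is `δ = 2 (x - log(1 + x)) / x² - 1`, so the exponent is
  -- exactly `-(n x² / 2)(1 + δ)`, and `n x² = α² n^(1-2β)`.
  refine ⟨_, ε, (isLittleO_one_iff ℝ).2 (tendsto_log_one_add_ratio hx
    ((eventually_ge_atTop 1).mono hx0)), hε, ?_⟩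
  filter_upwards [h, eventually_ge_atTop 1] with n hn hn1
  rw [hn]
  congr 3
  have h2 := nat_mul_lam_sub_one_sq hn1 α β
  have h3 := hx0 n hn1
  rw [add_sub_cancel, add_sub_cancel, neg_mul, neg_mul, neg_inj, div_mul_eq_mul_div, ← h2]
  field_simp

/-- Expansion of `1 / H n` above the transition window, uniform over `0 ≤ β < 1 / 2`. -/
theorem exists_one_div_H_eq_upper {α β : ℝ} (hβ0 : 0 ≤ β) (hβ : β < 1 / 2) (hα : 0 < α) :
    ∃ ε : ℕ → ℝ, ε =O[atTop] (fun n : ℕ => (n : ℝ) ^ (6 * β - 3)) ∧ ∀ᶠ n : ℕ in atTop,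
      1 / H n (n * lam α β n) = α * (n : ℝ) ^ (1 - β) *
        (1 + lam α β n * (n : ℝ) ^ (2 * β - 1) / α ^ 2 -
          lam α β n * (lam α β n + 1) * (n : ℝ) ^ (4 * β - 2) / α ^ 4 + ε n) := by
  refine ⟨fun n => 1 / H n (n * lam α β n) / (α * (n : ℝ) ^ (1 - β)) -
    (1 + lam α β n * (n : ℝ) ^ (2 * β - 1) / α ^ 2 -
          lam α β n * (lam α β n + 1) * (n : ℝ) ^ (4 * β - 2) / α ^ 4), ?_, ?_⟩
  · have hsmall : Tendsto (fun n : ℕ => (1 + α) / α ^ 2 * (n : ℝ) ^ (2 * β - 1)) atTop (𝓝 0) := by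
      simpa using (tendsto_natCast_rpow_neg (by linarith : 2 * β - 1 < 0)).const_mul _
    refine IsBigO.of_bound (56 * ((1 + α) / α ^ 2) ^ 3) ?_
    filter_upwards [eventually_ge_atTop 1,
      hsmall.eventually_le_const (by norm_num : (0 : ℝ) < 1 / 2)] with n hn hle
    have hn1 : (1 : ℝ) ≤ n := by exact_mod_cast hn
    have hn0 : (0 : ℝ) < n := by linarith
    -- In terms of `y`, `ν - n = α n y`, and all powers of `n` become rational expressions in `n`
    -- and `y`.
    obtain ⟨y, hy⟩ : ∃ y, y = (n : ℝ) ^ (-β) := ⟨_, rfl⟩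
    have hy0 : 0 < y := by rw [hy]; positivity
    have hy1 : y ≤ 1 := by
      rw [hy]
      exact Real.rpow_le_one_of_one_le_of_nonpos hn1 (by linarith)
    have hl : lam α β n = 1 + α * y := by rw [lam, hy]
    have p1 : (n : ℝ) ^ (1 - β) = n * y := by
      rw [hy, sub_eq_add_neg, Real.rpow_add hn0, Real.rpow_one]
    have p2 : (n : ℝ) ^ (2 * β - 1) = 1 / (n * y ^ 2) := by
      have : 2 * β - 1 = -(1 + (-β) * (2 : ℕ)) := by push_cast; ring
      rw [this, Real.rpow_neg hn0.le, Real.rpow_add hn0, Real.rpow_one, Real.rpow_mul_natCast hn0.le,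
        ← hy, one_div]
    have p4 : (n : ℝ) ^ (4 * β - 2) = (1 / (n * y ^ 2)) ^ 2 := by
      rw [← p2, ← Real.rpow_mul_natCast hn0.le]
      congr 1
      push_cast
      ring
    have p6 : (n : ℝ) ^ (6 * β - 3) = (1 / (n * y ^ 2)) ^ 3 := by
      rw [← p2, ← Real.rpow_mul_natCast hn0.le]
      congr 1
      push_cast
      ring
    have hlα : lam α β n ≤ 1 + α := by rw [hl]; nlinarith
    have hD : (n : ℝ) * lam α β n - n = n * (α * y) := by rw [hl]; ring
    have hν : (n : ℝ) < n * lam α β n := by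
      have : 0 < (n : ℝ) * (α * y) := by positivity
      linarith
    have ha : (n : ℝ) * lam α β n / (n * lam α β n - n) ^ 2 =
        lam α β n / α ^ 2 * (1 / (n * y ^ 2)) := by
      rw [hD]; field_simp
    have hb : (n : ℝ) * lam α β n * (n * lam α β n + n) / (n * lam α β n - n) ^ 4 =
        lam α β n * (lam α β n + 1) * (1 / (n * y ^ 2)) ^ 2 / α ^ 4 := by
      rw [hD]; field_simp
    have ha' : lam α β n / α ^ 2 * (1 / (n * y ^ 2)) ≤ (1 + α) / α ^ 2 * (1 / (n * y ^ 2)) := by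
      gcongr
    have hl0 : 0 < lam α β n := by rw [hl]; positivity
    rw [p2] at hle
    have key := abs_one_div_H_mul_sub_le hn hν (by rw [ha]; exact ha'.trans hle)
    rw [hb, ha, hD] at key
    have e1 : 1 / (H n (n * lam α β n) * (n * (α * y))) =
        1 / H n (n * lam α β n) / (α * (n * y)) := by
      rw [div_div]; ring_nf
    rw [e1] at key
    rw [p1, p2, p4, p6, Real.norm_eq_abs, Real.norm_eq_abs,
      abs_of_nonneg (by positivity : 0 ≤ (1 / (n * y ^ 2)) ^ 3), mul_div_right_comm (lam α β n)]
    refine key.trans ?_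
    rw [mul_assoc, ← mul_pow]
    gcongr
  · filter_upwards [eventually_ge_atTop 1] with n hn
    have hn0 : (0 : ℝ) < n := by exact_mod_cast hn
    have : α * (n : ℝ) ^ (1 - β) ≠ 0 := by positivity
    field_simp
    ring

/-- Expanding `λ_n` in the uniform expansion yields the extra powers `n^(β-1)`, `n^(3β-2)` and
`n^(2β-2)`. The last two are always `o(n^(4β-2))`; the first is so exactly when `β > 1/3`, hence the
indicator. The error `n^(6β-3)` is absorbed because `β < 1/2`. -/
theorem exists_one_div_H_eq_moderate_upper {α β : ℝ} (hβ0 : 0 < β) (hβ : β < 1 / 2)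
    (hα : 0 < α) :
    ∃ ε : ℕ → ℝ, ε =o[atTop] (fun n : ℕ => (n : ℝ) ^ (4 * β - 2)) ∧ ∀ᶠ n : ℕ in atTop,
      1 / H n (n * lam α β n) = α * (n : ℝ) ^ (1 - β) *
        (1 + (n : ℝ) ^ (2 * β - 1) / α ^ 2
          + (if β ≤ 1 / 3 then (1 : ℝ) else 0) * (n : ℝ) ^ (β - 1) / α
          - 2 * (n : ℝ) ^ (4 * β - 2) / α ^ 4 + ε n) := by
  obtain ⟨ε, hε, h⟩ := exists_one_div_H_eq_upper hβ0.le hβ hα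
  have o1 : (fun n : ℕ => (1 - if β ≤ 1 / 3 then (1 : ℝ) else 0) / α * (n : ℝ) ^ (β - 1))
      =o[atTop] (fun n : ℕ => (n : ℝ) ^ (4 * β - 2)) := by
    split_ifs with h3
    · simp
    · exact (isLittleO_natCast_rpow_rpow (by linarith)).const_mul_left _
  have o2 : (fun n : ℕ => (3 / α ^ 3) * (n : ℝ) ^ (3 * β - 2))
      =o[atTop] (fun n : ℕ => (n : ℝ) ^ (4 * β - 2)) :=
    (isLittleO_natCast_rpow_rpow (by linarith)).const_mul_left _
  have o3 : (fun n : ℕ => (1 / α ^ 2) * (n : ℝ) ^ (2 * β - 2))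
      =o[atTop] (fun n : ℕ => (n : ℝ) ^ (4 * β - 2)) :=
    (isLittleO_natCast_rpow_rpow (by linarith)).const_mul_left _
  have o4 := hε.trans_isLittleO (isLittleO_natCast_rpow_rpow (by linarith : 6 * β - 3 < 4 * β - 2))
  refine ⟨_, ((o1.sub o2).sub o3).add o4, ?_⟩
  filter_upwards [h, eventually_ge_atTop 1] with n hn hn1
  have hn0 : (0 : ℝ) < n := by exact_mod_cast hn1
  rw [hn, lam]
  have q1 : (n : ℝ) ^ (β - 1) = (n : ℝ) ^ (-β) * (n : ℝ) ^ (2 * β - 1) := by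
    rw [← Real.rpow_add hn0]; ring_nf
  have q2 : (n : ℝ) ^ (3 * β - 2) = (n : ℝ) ^ (-β) * (n : ℝ) ^ (4 * β - 2) := by
    rw [← Real.rpow_add hn0]; ring_nf
  have q3 : (n : ℝ) ^ (2 * β - 2) = (n : ℝ) ^ (-β) * ((n : ℝ) ^ (-β) * (n : ℝ) ^ (4 * β - 2)) := by
    rw [← Real.rpow_add hn0, ← Real.rpow_add hn0]; ring_nf
  rw [q1, q2, q3]
  field_simp
  ring

theorem exists_one_div_H_eq_large_upper {α : ℝ} (hα : 0 < α) :
    ∃ ε : ℕ → ℝ, ε =O[atTop] (fun n : ℕ => (n : ℝ) ^ (-3 : ℤ)) ∧ ∀ᶠ n : ℕ in atTop,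
      1 / H n (n * lam α 0 n) = α * n *
        (1 + (1 + α) / (α ^ 2 * n) - (1 + α) * (2 + α) / (α ^ 4 * (n : ℝ) ^ 2) + ε n) := by
  obtain ⟨ε, hε, h⟩ := exists_one_div_H_eq_upper le_rfl (by norm_num) hα
  refine ⟨ε, hε.trans_eventuallyEq (.of_forall fun n => ?_), ?_⟩
  · simp only [← Real.rpow_intCast]
    norm_num
  · filter_upwards [h, eventually_ge_atTop 1] with n hn hn1
    have hn0 : (0 : ℝ) < n := by exact_mod_cast hn1
    have q1 : (n : ℝ) ^ ((2 : ℝ) * 0 - 1) = 1 / n := by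
      rw [mul_zero, zero_sub, Real.rpow_neg_one, one_div]
    have q2 : (n : ℝ) ^ ((4 : ℝ) * 0 - 2) = 1 / (n : ℝ) ^ 2 := by
      rw [mul_zero, zero_sub, Real.rpow_neg hn0.le, Real.rpow_two, one_div]
    have hl : lam α 0 n = 1 + α := by simp [lam]
    rw [hn, q1, q2, hl, sub_zero, Real.rpow_one]
    field_simp
    ring

end SAWComplete

/-- Asymptotics of `1 / H_n(n λ_n)` as `n → ∞`, where `λ_n = 1 + α n^(-β)`, in all regimes.
Each term `o(·)` or `O(·)` is an error sequence, and each identity holds for all large `n`. -/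
theorem proposition3p1 (α β : ℝ) (hβ : 0 ≤ β) :
    -- `β = 0`, `-1 < α < 0`
    (β = 0 → -1 < α → α < 0 →
      ∃ ε : ℕ → ℝ, ε =o[atTop] (fun _ => (1 : ℝ)) ∧
        ∀ᶠ n : ℕ in atTop,
          1 / SAWComplete.H n (n * SAWComplete.lam α β n) =
            Real.sqrt (n / (2 * Real.pi)) * Real.exp (-(n * (α - Real.log (1 + α)))) *
              (1 + ε n)) ∧
    -- `0 < β < 1/2`, `α < 0`
    (0 < β → β < 1 / 2 → α < 0 →
      ∃ δ ε : ℕ → ℝ, δ =o[atTop] (fun _ => (1 : ℝ)) ∧ ε =o[atTop] (fun _ => (1 : ℝ)) ∧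
        ∀ᶠ n : ℕ in atTop,
          1 / SAWComplete.H n (n * SAWComplete.lam α β n) =
            Real.sqrt (n / (2 * Real.pi)) *
              Real.exp (-(α ^ 2 / 2) * (n : ℝ) ^ (1 - 2 * β) * (1 + δ n)) * (1 + ε n)) ∧
    -- `β = 1/2`
    (β = 1 / 2 →
      ∃ ε : ℕ → ℝ, ε =o[atTop] (fun _ => (1 : ℝ)) ∧
        ∀ᶠ n : ℕ in atTop,
          1 / SAWComplete.H n (n * SAWComplete.lam α β n) =
            SAWComplete.phi α / SAWComplete.PhiBar α * Real.sqrt n * (1 + ε n)) ∧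
    -- `β > 1/2`
    (1 / 2 < β →
      ∃ ε : ℕ → ℝ, ε =o[atTop] (fun _ => (1 : ℝ)) ∧
        ∀ᶠ n : ℕ in atTop,
          1 / SAWComplete.H n (n * SAWComplete.lam α β n) =
            Real.sqrt (2 / Real.pi) * Real.sqrt n * (1 + ε n)) ∧
    -- `0 < β < 1/2`, `α > 0`
    (0 < β → β < 1 / 2 → 0 < α →
      ∃ ε : ℕ → ℝ, ε =o[atTop] (fun n : ℕ => (n : ℝ) ^ (4 * β - 2)) ∧
        ∀ᶠ n : ℕ in atTop,
          1 / SAWComplete.H n (n * SAWComplete.lam α β n) =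
            α * (n : ℝ) ^ (1 - β) *
              (1 + (n : ℝ) ^ (2 * β - 1) / α ^ 2
                + (if β ≤ 1 / 3 then (1 : ℝ) else 0) * (n : ℝ) ^ (β - 1) / α
                - 2 * (n : ℝ) ^ (4 * β - 2) / α ^ 4 + ε n)) ∧
    -- `β = 0`, `α > 0`
    (β = 0 → 0 < α →
      ∃ ε : ℕ → ℝ, ε =O[atTop] (fun n : ℕ => (n : ℝ) ^ (-3 : ℤ)) ∧
        ∀ᶠ n : ℕ in atTop,
          1 / SAWComplete.H n (n * SAWComplete.lam α β n) =
            α * n *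
              (1 + (1 + α) / (α ^ 2 * n)
                - (1 + α) * (2 + α) / (α ^ 4 * (n : ℝ) ^ 2) + ε n)) := by
  refine ⟨?_, ?_, ?_, ?_, ?_, ?_⟩
  · rintro rfl hα1 hα
    have hl : ∀ n, SAWComplete.lam α 0 n = 1 + α := fun n => by simp [SAWComplete.lam]
    obtain ⟨ε, hε, h⟩ := SAWComplete.exists_one_div_H_eq_lower (β := 0) (by norm_num) hα
      (.of_forall fun n => by rw [hl]; linarith)
    refine ⟨ε, hε, h.mono fun n hn => ?_⟩
    rw [hn, hl, add_sub_cancel_left]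
  · exact SAWComplete.exists_one_div_H_eq_moderate_lower
  · rintro rfl
    refine SAWComplete.exists_one_div_H_eq_central (tendsto_const_nhds.congr' ?_)
      ((SAWComplete.tendsto_lam α (by norm_num)).eventually_const_lt one_pos)
    filter_upwards [eventually_ge_atTop 1] with n hn
    rw [SAWComplete.sqrt_mul_lam_sub_one hn, sub_self, Real.rpow_zero, mul_one]
  · intro h
    rw [← SAWComplete.phi_zero_div_PhiBar_zero]
    have hlim := (SAWComplete.tendsto_natCast_rpow_neg (sub_neg.2 h)).const_mul α
    rw [mul_zero] at hlim
    refine SAWComplete.exists_one_div_H_eq_central (hlim.congr' ?_)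
      ((SAWComplete.tendsto_lam α (by linarith)).eventually_const_lt one_pos)
    filter_upwards [eventually_ge_atTop 1] with n hn
    rw [SAWComplete.sqrt_mul_lam_sub_one hn]
  · exact SAWComplete.exists_one_div_H_eq_moderate_upper
  · rintro rfl
    exact SAWComplete.exists_one_div_H_eq_large_upper
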